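/- Let $\Sigma=\{a,b\}$ and let $\mathbb N=\{1,2,\dots\}$. A binary substitution is a homomorphism $\varrho:\Sigma^*\to\Sigma^*$ (for concatenation); it acts on infinite words letter by letter. It is primitive if for some $p\ge 1$ both letters occur in $\varrho^p(a)$ and in $\varrho^p(b)$. Its substitution matrix is $$M_\varrho=\begin{bmatrix}|\varrho(a)|_a&|\varrho(b)|_a\\|\varrho(a)|_b&|\varrho(b)|_b\end{bmatrix},$$ where $|u|_\alpha$ is the number of occurrences of the letter $\alpha$ in $u$. For an infinite word $w=\ell_0\ell_1\ell_2\cdots$ over $\Sigma$ in which both letters occur infinitely often, let $p_a(n)$ and $p_b(n)$ be the positions (counted from $0$) of the $n$-th $a$ and the $n$-th $b$ in $w$, and let $r(n)=p_b(n)-p_a(n)$ for $n\in\mathbb N$. For $k\in\mathbb N$ put $\tau_k=\frac{k+\sqrt{k^2+4}}{2}$. A right Perron--Frobenius eigenvector of $M_\varrho$ is a vector $v$ with positive entries such that $M_\varrho v=\lambda v$, where $\lambda$ is the Perron--Frobenius eigenvalue of $M_\varrho$ (the real eigenvalue that is at least the modulus of every complex eigenvalue). **Theorem.** Let $\varrho$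 be a primitive binary substitution with substitution matrix $M_\varrho$, let $w$ be a one-sided infinite word in which both letters occur infinitely often and such that $\varrho(w)=w$, let $r$ be the relative position function of $w$, and let $k\in\mathbb N$. (a) The following are equivalent: (i) $\lim_{n\to\infty} r(n)/n=k$; (ii) $[\tau_k\ \ 1]^T$ is a right Perron--Frobenius eigenvector of $M_\varrho$; (iii) there exist integers $m\ge1$ and $n\ge0$ such that $M_\varrho=\begin{bmatrix}km+n&m\\m&n\end{bmatrix}$. (b) The following are equivalent: (i) $\lim_{n\to\infty} r(n)/n=-k$; (ii) $[1\ \ \tau_k]^T$ is a right Perron--Frobenius eigenvector of $M_\varrho$; (iii) there exist integers $m\ge1$ and $n\ge0$ such that $M_\varrho=\begin{bmatrix}n&m\\m&km+n\end{bmatrix}$. (c) The following are equivalent: (i) $\lim_{n\to\infty} r(n)/n=0$; (ii) $[1\ \ 1]^T$ is a right Perron--Frobenius eigenvector of $M_\varrho$; (iii) there exist integers $a,b,c,d\ge0$ with $a+b=c+d$ such that $M_\varrho=\begin{bmatrix}a&b\\c&d\end{bmatrix}$. -/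

import Mathlib

open Filter Topology

namespace BinarySubst

/-- The binary alphabet: the letter `a` is `0` and the letter `b` is `1`. -/
abbrev Letter := Fin 2

/-- The letter `a`. -/
abbrev ltrA : Letter := 0

/-- The letter `b`. -/
abbrev ltrB : Letter := 1

/-- One-sided infinite binary words `w 0, w 1, w 2, …`. -/
abbrev InfWord := ℕ → Letter

/-- The set of infinite words in which both letters occur infinitely often. -/
def infBoth : Set InfWord :=
  {w | {i | w i = ltrA}.Infinite ∧ {i | w i = ltrB}.Infinite}

/-- The position (positions start at `0`) of the `n`-th occurrence, `n ≥ 1`, of the letter `α`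
in `w`. The value at `n = 0` is irrelevant. -/
noncomputable def pos (α : Letter) (w : InfWord) (n : ℕ) : ℕ :=
  Nat.nth (fun i => w i = α) (n - 1)

/-- The relative position function `r(n) = p_b(n) - p_a(n)`, `n ≥ 1`. -/
noncomputable def relPos (w : InfWord) (n : ℕ) : ℤ :=
  (pos ltrB w n : ℤ) - (pos ltrA w n : ℤ)

/-- The prefix `w 0 ⋯ w (n-1)` of length `n` of an infinite word. -/
def prefixWord (w : InfWord) (n : ℕ) : List Letter := (List.range n).map w

/-- A binary substitution, given by the images of the two letters. -/
abbrev Substitution := Letter → List Letter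

/-- The action of a substitution on finite words, as a homomorphism for concatenation. -/
def Substitution.onWord (ρ : Substitution) (u : List Letter) : List Letter := u.flatMap ρ

/-- The infinite word `v` is the image of the infinite word `w` under `ρ`, that is, the infinite
concatenation `ρ(w 0) ρ(w 1) ρ(w 2) ⋯`. -/
def Substitution.IsImage (ρ : Substitution) (w v : InfWord) : Prop :=
  (∀ n, ρ.onWord (prefixWord w n) = prefixWord v (ρ.onWord (prefixWord w n)).length) ∧
    ∀ L, ∃ n, L ≤ (ρ.onWord (prefixWord w n)).length

/-- `w` is a one-sided fixed point: `ρ(w) = w`. -/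
def Substitution.IsFixedPoint (ρ : Substitution) (w : InfWord) : Prop := ρ.IsImage w w

/-- `ρ` is primitive: for some `p ≥ 1`, every letter occurs in the `p`-th iterate of `ρ` on every
letter. -/
def Substitution.IsPrimitive (ρ : Substitution) : Prop :=
  ∃ p : ℕ, 1 ≤ p ∧ ∀ α β : Letter, α ∈ ρ.onWord^[p] [β]

/-- The substitution matrix: the entry `(α, β)` counts the letter `α` in `ρ(β)`. -/
def Substitution.matrix (ρ : Substitution) : Matrix (Fin 2) (Fin 2) ℕ :=
  Matrix.of fun α β => (ρ β).count α

/-- `v` is a right Perron–Frobenius eigenvector of the nonnegative matrix `M`: a vector with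
positive entries that is an eigenvector for the Perron–Frobenius eigenvalue, i.e. for a
real eigenvalue which is at least the modulus of every complex eigenvalue of `M`. -/
def IsRightPFEigenvector (M : Matrix (Fin 2) (Fin 2) ℕ) (v : Fin 2 → ℝ) : Prop :=
  (∀ i, 0 < v i) ∧
    ∃ l : ℝ, Module.End.HasEigenvector (Matrix.toLin' (M.map (Nat.cast : ℕ → ℝ))) l v ∧
      ∀ z : ℂ, Module.End.HasEigenvalue (Matrix.toLin' (M.map (Nat.cast : ℕ → ℂ))) z → ‖z‖ ≤ l

/-- `τ_k = (k + √(k² + 4)) / 2`. -/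
noncomputable def tau (k : ℕ) : ℝ := ((k : ℝ) + √((k : ℝ) ^ 2 + 4)) / 2

end BinarySubst

namespace BinarySubst

/-! Write the matrix as `[a b; c d]`. Primitivity gives `b, c > 0`, so `c x² + d x = a x + b` has
exactly one positive root `x`; it is the ratio of the entries of a positive eigenvector. The row
vectors `(1, -x)` and `(c x, b)` are left eigenvectors with eigenvalues `θ = a - x c` and `lam = c x
+ d`, and `|θ| < lam`. Since `w` is fixed, every prefix is, up to a bounded suffix, the image of
another prefix; iterating shows that `#a - x #b` is `o(N)` on prefixes of length `N`
(`tendsto_discrepancy`).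

So the letter frequencies are `x/(x+1)` and `1/(x+1)`. Inverting them gives the growth of the
positions, and `r(n)/n` always converges, to `(x+1) - (x+1)/x = x - 1/x`. Each limit condition thus
fixes `x`: as `τ_k`, `1/τ_k` or `1`. For `k ≥ 1`, irrationality of `τ_k` splits the quadratic into
integer identities for the matrix entries. -/

lemma letter_eq_of_ne {α β γ : Letter} (h : α ≠ β) (hγ : γ ≠ α) : γ = β := by
  revert α β γ
  decide

lemma letter_eq_or (α : Letter) : α = ltrA ∨ α = ltrB := by
  revert α
  decide

/-- Otherwise no iterate of `ρ` on `β` ever produces `α`. -/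
lemma Substitution.IsPrimitive.mem_of_ne {ρ : Substitution} (hρ : ρ.IsPrimitive)
    {α β : Letter} (hαβ : α ≠ β) : α ∈ ρ β := by
  by_contra hmem
  obtain ⟨p, -, hp⟩ := hρ
  have key : ∀ p, α ∉ ρ.onWord^[p] [β] := by
    intro p
    induction p with
    | zero => simpa using hαβ
    | succ p ih =>
      rw [Function.iterate_succ_apply', Substitution.onWord, List.mem_flatMap]
      rintro ⟨γ, hγ, hα⟩
      have hne : γ ≠ α := fun h => ih (h ▸ hγ)
      exact hmem (letter_eq_of_ne hαβ hne ▸ hα)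
  exact key p (hp α β)

/-- Otherwise each image avoids its own letter, and every iterate on `a` uses at most one letter.
This yields positive trace, which excludes `θ = -lam`. -/
lemma Substitution.IsPrimitive.exists_mem_self {ρ : Substitution} (hρ : ρ.IsPrimitive) :
    ∃ α : Letter, α ∈ ρ α := by
  by_contra! hmem
  obtain ⟨p, -, hp⟩ := hρ
  have key : ∀ p, ∃ γ, ∀ δ ∈ ρ.onWord^[p] [ltrA], δ ≠ γ := by
    intro p
    induction p with
    | zero => exact ⟨ltrB, by simp⟩
    | succ p ih =>
      obtain ⟨γ, hγ⟩ := ih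
      -- Addition is modulo 2: the missing letter alternates.
      refine ⟨γ + 1, fun δ hδ => ?_⟩
      rw [Function.iterate_succ_apply', Substitution.onWord, List.mem_flatMap] at hδ
      obtain ⟨ε, hε, hδε⟩ := hδ
      have h1 : ε ≠ γ := hγ ε hε
      have h2 : δ ≠ ε := by
        rintro rfl
        exact hmem _ hδε
      clear hγ hε hδε
      revert γ δ ε
      decide
  obtain ⟨γ, hγ⟩ := key p
  exact hγ γ (hp γ ltrA) rfl

/-! ### Letter counts in prefixes and their images -/

lemma count_onWord (ρ : Substitution) (α : Letter) (u : List Letter) :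
    (ρ.onWord u).count α =
      ρ.matrix α ltrA * u.count ltrA + ρ.matrix α ltrB * u.count ltrB := by
  induction u with
  | nil => simp [Substitution.onWord]
  | cons γ u ih =>
    have hcons : ρ.onWord (γ :: u) = ρ γ ++ ρ.onWord u := by simp [Substitution.onWord]
    rw [hcons, List.count_append, ih]
    fin_cases γ <;> simp [Substitution.matrix] <;> ring

lemma prefixWord_succ (w : InfWord) (n : ℕ) : prefixWord w (n + 1) = prefixWord w n ++ [w n] := by
  simp [prefixWord, List.range_succ]

lemma count_prefixWord (w : InfWord) (α : Letter) (n : ℕ) :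
    (prefixWord w n).count α = Nat.count (fun i => w i = α) n := by
  induction n with
  | zero => simp [prefixWord]
  | succ n ih =>
    rw [prefixWord_succ, List.count_append, ih, Nat.count_succ]
    simp [List.count_singleton]

lemma count_add_count (w : InfWord) (n : ℕ) :
    Nat.count (fun i => w i = ltrA) n + Nat.count (fun i => w i = ltrB) n = n := by
  induction n with
  | zero => simp
  | succ n ih =>
    rw [Nat.count_succ, Nat.count_succ]
    rcases letter_eq_or (w n) with h | h <;> simp [h] <;> omega

/-- The prefixes of a fixed point that are images of prefixes lie at bounded distance from all
prefixes. -/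
lemma Substitution.IsFixedPoint.exists_image_prefix {ρ : Substitution} {w : InfWord}
    (hfix : ρ.IsFixedPoint w) (N : ℕ) :
    ∃ n L, L ≤ N ∧ N ≤ L + ((ρ ltrA).length + (ρ ltrB).length) ∧
      ∀ α, Nat.count (fun i => w i = α) L =
        ρ.matrix α ltrA * Nat.count (fun i => w i = ltrA) n +
          ρ.matrix α ltrB * Nat.count (fun i => w i = ltrB) n := by
  -- At the least such prefix length, dropping the last letter brings the image back to length at
  -- most `N`, and this removes only one block `ρ (w m)`.
  have hex : ∃ n, N < (ρ.onWord (prefixWord w n)).length := hfix.2 (N + 1)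
  obtain ⟨m, hm⟩ : ∃ m, Nat.find hex = m + 1 := by
    refine Nat.exists_eq_succ_of_ne_zero fun h => ?_
    have := Nat.find_spec hex
    rw [h] at this
    simp [prefixWord, Substitution.onWord] at this
  refine ⟨m, (ρ.onWord (prefixWord w m)).length, ?_, ?_, fun α => ?_⟩
  · exact not_lt.1 (Nat.find_min hex (by omega))
  · have h := Nat.find_spec hex
    have happ : ρ.onWord (prefixWord w m ++ [w m]) = ρ.onWord (prefixWord w m) ++ ρ (w m) := by
      simp [Substitution.onWord]
    rw [hm, prefixWord_succ, happ, List.length_append] at h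
    have hle : (ρ (w m)).length ≤ (ρ ltrA).length + (ρ ltrB).length := by
      rcases letter_eq_or (w m) with h | h <;> rw [h] <;> omega
    omega
  · rw [← count_prefixWord, ← hfix.1 m, count_onWord, count_prefixWord, count_prefixWord]

/-! ### Contraction of the discrepancy -/

lemma abs_linear_sub_le {f : ℕ → ℕ} {g : ℕ → ℕ} (hfg : ∀ n, f n + g n = n) (hf : Monotone f)
    (hg : Monotone g) (x : ℝ) {L N C : ℕ} (hL : L ≤ N) (hN : N ≤ L + C) :
    |((f N : ℝ) - x * g N) - ((f L : ℝ) - x * g L)| ≤ (1 + |x|) * C := by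
  have h1 : (f L : ℝ) ≤ f N := by exact_mod_cast hf hL
  have h2 : (g L : ℝ) ≤ g N := by exact_mod_cast hg hL
  have h3 : (f N : ℝ) + g N ≤ f L + g L + C := by
    exact_mod_cast (by rw [hfg, hfg]; exact hN : f N + g N ≤ f L + g L + C)
  have e : ((f N : ℝ) - x * g N) - ((f L : ℝ) - x * g L)
      = ((f N : ℝ) - f L) - x * ((g N : ℝ) - g L) := by ring
  rw [e]
  refine (abs_sub _ _).trans ?_
  rw [abs_mul, abs_of_nonneg (sub_nonneg.2 h1), abs_of_nonneg (sub_nonneg.2 h2), add_mul, one_mul]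
  refine add_le_add (by linarith) (mul_le_mul_of_nonneg_left (by linarith) (abs_nonneg x))

/-- If `D` is contracted relative to the weight `l` along a renormalization, then `D = o(l)` up to
additive constants. -/
lemma exists_le_pow_mul_add {D l : ℕ → ℝ} {θ q K C : ℝ} (hq : 0 ≤ q)
    (hK : 0 ≤ K) (hD : ∀ n, |D n| ≤ K * l n)
    (hstep : ∀ N, ∃ n, |D N| ≤ |θ| * |D n| + C ∧ |θ| * l n ≤ q * l N) (j : ℕ) :
    ∃ B, ∀ N, |D N| ≤ K * q ^ j * l N + B := by
  induction j with
  | zero => exact ⟨0, by simpa using hD⟩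
  | succ j ih =>
    obtain ⟨B, hB⟩ := ih
    refine ⟨|θ| * B + C, fun N => ?_⟩
    obtain ⟨n, h1, h2⟩ := hstep N
    calc |D N| ≤ |θ| * |D n| + C := h1
      _ ≤ |θ| * (K * q ^ j * l n + B) + C := by gcongr; exact hB n
      _ = K * q ^ j * (|θ| * l n) + (|θ| * B + C) := by ring
      _ ≤ K * q ^ j * (q * l N) + (|θ| * B + C) := by gcongr
      _ = _ := by ring

lemma tendsto_div_natCast_zero {D : ℕ → ℝ}
    (h : ∀ ε > 0, ∃ B, ∀ N : ℕ, |D N| ≤ ε * N + B) :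
    Tendsto (fun N : ℕ => D N / N) atTop (𝓝 0) := by
  rw [Metric.tendsto_atTop]
  intro ε hε
  obtain ⟨B, hB⟩ := h (ε / 2) (by positivity)
  obtain ⟨N₀, hN₀⟩ := exists_nat_gt (2 * B / ε)
  refine ⟨N₀ + 1, fun N hN => ?_⟩
  have hN1 : (N₀ : ℝ) + 1 ≤ N := by exact_mod_cast hN
  have hpos : (0 : ℝ) < N := by have : (0 : ℝ) ≤ N₀ := N₀.cast_nonneg; linarith
  rw [Real.dist_eq, sub_zero, abs_div, abs_of_pos hpos, div_lt_iff₀ hpos]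
  have h1 : 2 * B < N * ε := (div_lt_iff₀ hε).1 (by linarith)
  have := hB N
  linarith

/-- In a fixed point of a primitive substitution the ratio of the letter frequencies is the ratio
`x` of the entries of a positive eigenvector. -/
lemma tendsto_discrepancy {ρ : Substitution} (hρ : ρ.IsPrimitive) {w : InfWord}
    (hfix : ρ.IsFixedPoint w) {x : ℝ} (hx : 0 < x)
    (heq : (ρ.matrix 1 0 : ℝ) * x ^ 2 + ρ.matrix 1 1 * x = ρ.matrix 0 0 * x + ρ.matrix 0 1) :
    Tendsto (fun N : ℕ => ((Nat.count (fun i => w i = ltrA) N : ℝ)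
      - x * Nat.count (fun i => w i = ltrB) N) / N) atTop (𝓝 0) := by
  have hb : (0 : ℝ) < ρ.matrix 0 1 := by
    exact_mod_cast List.count_pos_iff.2 (hρ.mem_of_ne (by decide : ltrA ≠ ltrB))
  have hc : (0 : ℝ) < ρ.matrix 1 0 := by
    exact_mod_cast List.count_pos_iff.2 (hρ.mem_of_ne (by decide : ltrB ≠ ltrA))
  have ha0 : (0 : ℝ) ≤ ρ.matrix 0 0 := Nat.cast_nonneg _
  have hd0 : (0 : ℝ) ≤ ρ.matrix 1 1 := Nat.cast_nonneg _
  have had : (0 : ℝ) < ρ.matrix 0 0 + ρ.matrix 1 1 := by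
    obtain ⟨α, hα⟩ := hρ.exists_mem_self
    have hpos : (0 : ℝ) < ρ.matrix α α := by exact_mod_cast List.count_pos_iff.2 hα
    fin_cases α <;> simp only [Fin.zero_eta, Fin.mk_one] at hpos <;> linarith
  have himg := hfix.exists_image_prefix
  set f := Nat.count (fun i => w i = ltrA)
  set g := Nat.count (fun i => w i = ltrB)
  have hfm : Monotone f := Nat.count_monotone _
  have hgm : Monotone g := Nat.count_monotone _
  have hfg : ∀ n, f n + g n = n := count_add_count w
  generalize (ρ ltrA).length + (ρ ltrB).length = C at himg
  set a : ℝ := (ρ.matrix 0 0 : ℝ)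
  set b : ℝ := (ρ.matrix 0 1 : ℝ)
  set c : ℝ := (ρ.matrix 1 0 : ℝ)
  set d : ℝ := (ρ.matrix 1 1 : ℝ)
  -- `θ` and `c * x + d` are the two eigenvalues
  set θ : ℝ := a - x * c with hθ
  set lam : ℝ := c * x + d with hlam
  have hlam0 : 0 < lam := by positivity
  have hbx : a * x + b = lam * x := by rw [hlam]; linarith
  have hθlt : |θ| < lam := by
    have : 0 < x * c := by positivity
    have h1 : a < lam := by
      by_contra! h
      nlinarith
    exact abs_lt.2 ⟨by linarith, by linarith⟩
  -- The left eigenvector for `lam` serves as a weight comparable to length.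
  set l : ℕ → ℝ := fun n => c * x * f n + b * g n with hl
  have hlmono : Monotone l := fun m n hmn => by
    have h1 : (f m : ℝ) ≤ f n := by exact_mod_cast hfm hmn
    have h2 : (g m : ℝ) ≤ g n := by exact_mod_cast hgm hmn
    simp only [hl]
    gcongr
  set D : ℕ → ℝ := fun n => (f n : ℝ) - x * g n with hDdef
  have hl0 : ∀ n, 0 ≤ l n := fun n => by simp only [hl]; positivity
  have hDl : ∀ n, |D n| ≤ (1 / (c * x) + x / b) * l n := fun n => by
    have h1 : |D n| ≤ f n + x * g n := by
      refine (abs_sub _ _).trans (le_of_eq ?_)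
      rw [abs_of_nonneg (Nat.cast_nonneg _), abs_of_nonneg (by positivity)]
    have h2 : (1 / (c * x) + x / b) * l n
        = f n + x * g n + (b / (c * x) * g n + x / b * (c * x) * f n) := by
      simp only [hl]
      field_simp
      ring
    have h3 : 0 ≤ b / (c * x) * g n + x / b * (c * x) * f n := by positivity
    linarith
  have hstep : ∀ N, ∃ n, |D N| ≤ |θ| * |D n| + (1 + |x|) * C ∧
      |θ| * l n ≤ (|θ| / lam) * l N := fun N => by
    obtain ⟨n, L, hL, hN, hcount⟩ := himg N
    have hfL : (f L : ℝ) = a * f n + b * g n :=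
      (congrArg (Nat.cast (R := ℝ)) (hcount 0)).trans (by push_cast; rfl)
    have hgL : (g L : ℝ) = c * f n + d * g n :=
      (congrArg (Nat.cast (R := ℝ)) (hcount 1)).trans (by push_cast; rfl)
    have hDL : D L = θ * D n := by
      simp only [hDdef]
      rw [hfL, hgL, hθ]
      linear_combination (-(g n : ℝ)) * heq
    have hlL : l L = lam * l n := by
      simp only [hl]
      rw [hfL, hgL]
      linear_combination (c * f n : ℝ) * hbx
    refine ⟨n, ?_, ?_⟩
    · have h1 := abs_linear_sub_le hfg hfm hgm x hL hN
      have h2 := abs_sub_abs_le_abs_sub (D N) (D L)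
      have h3 : |D N - D L| ≤ (1 + |x|) * C := h1
      rw [hDL, abs_mul] at h2
      rw [hDL] at h3
      linarith
    · have h1 : lam * l n ≤ l N := hlL ▸ hlmono hL
      calc |θ| * l n = |θ| / lam * (lam * l n) := by field_simp
        _ ≤ _ := by gcongr
  refine tendsto_div_natCast_zero fun ε hε => ?_
  have hq0 : 0 ≤ |θ| / lam := by positivity
  have hq1 : |θ| / lam < 1 := (div_lt_one hlam0).2 hθlt
  set K := 1 / (c * x) + x / b
  have hK : 0 < K := by positivity
  -- The threshold comes from `l N ≤ (c * x + b) * N`. The additive constant depends on `j`, but `j`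
  -- is fixed once `ε` is.
  obtain ⟨j, hj⟩ := exists_pow_lt_of_lt_one
    (show 0 < ε / (K * (c * x + b)) by positivity) hq1
  obtain ⟨B, hB⟩ := exists_le_pow_mul_add hq0 hK.le hDl hstep j
  refine ⟨B, fun N => (hB N).trans ?_⟩
  have hlN : l N ≤ (c * x + b) * N := by
    have h : (f N : ℝ) + g N = N := by exact_mod_cast hfg N
    simp only [hl]
    rw [← h]
    have : 0 ≤ c * x * g N + b * f N := by positivity
    linarith
  have hpow : K * (|θ| / lam) ^ j * (c * x + b) ≤ ε := by
    rw [lt_div_iff₀ (by positivity)] at hj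
    linarith
  have : K * (|θ| / lam) ^ j * l N ≤ ε * N := by
    calc K * (|θ| / lam) ^ j * l N ≤ K * (|θ| / lam) ^ j * ((c * x + b) * N) := by gcongr
      _ = K * (|θ| / lam) ^ j * (c * x + b) * N := by ring
      _ ≤ _ := by gcongr
  linarith

/-! ### From letter frequencies to positions -/

lemma tendsto_pos_div {w : InfWord} {α : Letter} (hinf : {i | w i = α}.Infinite) {y : ℝ}
    (hy : 0 < y)
    (h : Tendsto (fun N : ℕ => (Nat.count (fun i => w i = α) N : ℝ) / N) atTop (𝓝 y)) :
    Tendsto (fun n : ℕ => (pos α w n : ℝ) / n) atTop (𝓝 y⁻¹) := by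
  have hmono : StrictMono (Nat.nth fun i => w i = α) := Nat.nth_strictMono hinf
  have htop : Tendsto (fun n : ℕ => Nat.nth (fun i => w i = α) n) atTop atTop :=
    hmono.tendsto_atTop
  have h1 : Tendsto (fun n : ℕ => (Nat.nth (fun i => w i = α) n : ℝ) / n) atTop (𝓝 y⁻¹) := by
    refine ((h.comp htop).inv₀ hy.ne').congr fun n => ?_
    simp only [Function.comp_apply]
    rw [Nat.count_nth_of_infinite hinf, inv_div]
  have h2 : Tendsto (fun n : ℕ => (n : ℝ) / ((n + 1 : ℕ) : ℝ)) atTop (𝓝 1) := by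
    simpa using tendsto_natCast_div_add_atTop (1 : ℝ)
  -- `pos` at `n + 1` is `Nat.nth` at `n`; the factor `n / (n + 1)` absorbs the shift.
  rw [← tendsto_add_atTop_iff_nat 1]
  have h3 := h1.mul h2
  rw [mul_one] at h3
  refine h3.congr' ?_
  filter_upwards [eventually_gt_atTop 0] with n hn
  have : (n : ℝ) ≠ 0 := by exact_mod_cast hn.ne'
  simp only [pos, Nat.add_sub_cancel]
  field_simp

/-- If the counts of the two letters have ratio tending to `x`, then `r(n)/n → x - 1/x`. -/
lemma tendsto_relPos_div {w : InfWord} (hw : w ∈ infBoth) {x : ℝ} (hx : 0 < x)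
    (h : Tendsto (fun N : ℕ => ((Nat.count (fun i => w i = ltrA) N : ℝ)
      - x * Nat.count (fun i => w i = ltrB) N) / N) atTop (𝓝 0)) :
    Tendsto (fun n : ℕ => (relPos w n : ℝ) / n) atTop (𝓝 (x - x⁻¹)) := by
  have hx1 : x + 1 ≠ 0 := by positivity
  have hsum : ∀ N : ℕ, (Nat.count (fun i => w i = ltrA) N : ℝ)
      + Nat.count (fun i => w i = ltrB) N = N := fun N => by
    exact_mod_cast count_add_count w N
  have hA : Tendsto (fun N : ℕ => (Nat.count (fun i => w i = ltrA) N : ℝ) / N) atTop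
      (𝓝 (x / (x + 1))) := by
    have h1 := (h.add_const x).div_const (x + 1)
    rw [zero_add] at h1
    refine h1.congr' ?_
    filter_upwards [eventually_gt_atTop 0] with N hN
    have hN' : (N : ℝ) ≠ 0 := by exact_mod_cast hN.ne'
    field_simp
    linear_combination (-x) * hsum N
  have hB : Tendsto (fun N : ℕ => (Nat.count (fun i => w i = ltrB) N : ℝ) / N) atTop
      (𝓝 (1 / (x + 1))) := by
    have h1 := (h.const_sub 1).div_const (x + 1)
    rw [sub_zero] at h1
    refine h1.congr' ?_
    filter_upwards [eventually_gt_atTop 0] with N hN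
    have hN' : (N : ℝ) ≠ 0 := by exact_mod_cast hN.ne'
    field_simp
    linear_combination (-1 : ℝ) * hsum N
  have h2 := (tendsto_pos_div hw.2 (by positivity) hB).sub
    (tendsto_pos_div hw.1 (by positivity) hA)
  have e : (1 / (x + 1))⁻¹ - (x / (x + 1))⁻¹ = x - x⁻¹ := by
    field_simp
    ring
  rw [e] at h2
  refine h2.congr fun n => ?_
  simp only [relPos]
  push_cast
  ring

/-! ### Perron–Frobenius eigenvectors -/

/-- A nonnegative matrix with a positive eigenvector has no eigenvalue of larger modulus. -/
lemma norm_le_of_pos_eigenvector {M : Matrix (Fin 2) (Fin 2) ℕ} {v : Fin 2 → ℝ}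
    (hv : ∀ i, 0 < v i) {l : ℝ}
    (hl : ∀ i, (M i 0 : ℝ) * v 0 + M i 1 * v 1 = l * v i) {z : ℂ}
    (hz : Module.End.HasEigenvalue (Matrix.toLin' (M.map (Nat.cast : ℕ → ℂ))) z) : ‖z‖ ≤ l := by
  obtain ⟨u, hu⟩ := hz.exists_hasEigenvector
  have hu0 := hu.2
  have hue := hu.apply_eq_smul
  have hcoord : ∀ i, (M i 0 : ℂ) * u 0 + M i 1 * u 1 = z * u i := fun i => by
    have := congrFun hue i
    simpa [Matrix.toLin'_apply, Matrix.mulVec, dotProduct, Fin.sum_univ_two] using this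
  -- At a coordinate maximizing `‖u i‖ / v i`, the triangle inequality compares row `i` for `u` with
  -- row `i` for `v`.
  obtain ⟨i, hi⟩ := Finite.exists_max fun i => ‖u i‖ / v i
  set s := ‖u i‖ / v i with hs
  have hle : ∀ j, ‖u j‖ ≤ s * v j := fun j => (div_le_iff₀ (hv j)).1 (hi j)
  have hspos : 0 < s := by
    obtain ⟨j, hj⟩ := Function.ne_iff.1 hu0
    exact lt_of_lt_of_le (div_pos (norm_pos_iff.2 hj) (hv j)) (hi j)
  have hui : ‖u i‖ = s * v i := by rw [hs, div_mul_cancel₀ _ (hv i).ne']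
  have h1 : ‖z‖ * (s * v i) ≤ l * (s * v i) := by
    calc ‖z‖ * (s * v i) = ‖(M i 0 : ℂ) * u 0 + M i 1 * u 1‖ := by
          rw [hcoord, norm_mul, hui]
      _ ≤ M i 0 * ‖u 0‖ + M i 1 * ‖u 1‖ := by
          refine (norm_add_le _ _).trans (le_of_eq ?_)
          simp
      _ ≤ M i 0 * (s * v 0) + M i 1 * (s * v 1) := by
          gcongr <;> exact hle _
      _ = l * (s * v i) := by linear_combination s * hl i
  exact le_of_mul_le_mul_right h1 (mul_pos hspos (hv i))

/-- A vector with positive entries is a right Perron–Frobenius eigenvector if and only if it is an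
eigenvector, which amounts to a quadratic equation. -/
lemma isRightPFEigenvector_iff (M : Matrix (Fin 2) (Fin 2) ℕ) {s t : ℝ} (hs : 0 < s)
    (ht : 0 < t) :
    IsRightPFEigenvector M ![s, t] ↔
      (M 1 0 : ℝ) * s ^ 2 + M 1 1 * (s * t) = M 0 0 * (s * t) + M 0 1 * t ^ 2 := by
  have hpos : ∀ i, 0 < (![s, t] : Fin 2 → ℝ) i := fun i => by fin_cases i <;> simpa
  constructor
  · rintro ⟨-, l, hl, -⟩
    have hle := hl.apply_eq_smul
    have h0 := congrFun hle 0
    have h1 := congrFun hle 1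
    simp [Matrix.toLin'_apply, Matrix.mulVec, dotProduct, Fin.sum_univ_two] at h0 h1
    linear_combination s * h1 - t * h0
  · intro h
    set l : ℝ := (M 1 0 * s + M 1 1 * t) / t with hl
    have h1 : (M 1 0 : ℝ) * s + M 1 1 * t = l * t := by rw [hl]; field_simp
    have h0 : (M 0 0 : ℝ) * s + M 0 1 * t = l * s := by
      rw [hl]
      field_simp
      linear_combination (-1 : ℝ) * h
    have hcoord : ∀ i, (M i 0 : ℝ) * ![s, t] 0 + M i 1 * ![s, t] 1 = l * ![s, t] i := by
      intro i
      fin_cases i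
      · simpa using h0
      · simpa using h1
    refine ⟨hpos, l, ⟨Module.End.mem_eigenspace_iff.2 ?_, fun h => ?_⟩,
      fun z hz => norm_le_of_pos_eigenvector hpos hcoord hz⟩
    · ext i
      simpa [Matrix.toLin'_apply, Matrix.mulVec, dotProduct, Fin.sum_univ_two] using hcoord i
    · exact hs.ne' (by simpa using congrFun h 0)

/-! ### The quadratic equation and the numbers `τ_k` -/

lemma exists_pos_root {a b c d : ℝ} (hb : 0 < b) (hc : 0 < c) :
    ∃ x : ℝ, 0 < x ∧ c * x ^ 2 + d * x = a * x + b := by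
  have hsq := Real.sq_sqrt (show 0 ≤ (a - d) ^ 2 + 4 * (b * c) by positivity)
  have hlt : |a - d| < √((a - d) ^ 2 + 4 * (b * c)) := by
    refine Real.lt_sqrt_of_sq_lt ?_
    rw [sq_abs]
    have : 0 < b * c := by positivity
    linarith
  set q := √((a - d) ^ 2 + 4 * (b * c))
  refine ⟨((a - d) + q) / (2 * c), div_pos ?_ (by positivity), ?_⟩
  · linarith [neg_abs_le (a - d)]
  · field_simp
    linear_combination hsq

lemma pos_root_unique {a b c d x y : ℝ} (hb : 0 < b) (hc : 0 < c) (hx : 0 < x) (hy : 0 < y)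
    (h : c * x ^ 2 + d * x = a * x + b) (h' : c * y ^ 2 + d * y = a * y + b) : x = y := by
  -- This combination cancels the terms in `a` and `d`, leaving a factor that is positive.
  have key : (x - y) * (c * x * y + b) = 0 := by linear_combination y * h - x * h'
  rcases mul_eq_zero.1 key with h | h
  · linarith
  · have : 0 < c * x * y := by positivity
    linarith

lemma tau_pos (k : ℕ) : 0 < tau k := by
  have : 0 < √((k : ℝ) ^ 2 + 4) := Real.sqrt_pos.2 (by positivity)
  unfold tau
  positivity

lemma tau_sq (k : ℕ) : tau k ^ 2 = k * tau k + 1 := by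
  have := Real.sq_sqrt (show 0 ≤ (k : ℝ) ^ 2 + 4 by positivity)
  unfold tau
  linear_combination this / 4

/-- `k² + 4` lies strictly between `k²` and `(k + 2)²`, and differs from `(k + 1)²` by parity. For
`k = 0` this fails, since `τ_0 = 1`. -/
lemma irrational_tau {k : ℕ} (hk : 1 ≤ k) : Irrational (tau k) := by
  have hns : ¬ IsSquare (k ^ 2 + 4) := by
    rintro ⟨r, hr⟩
    have h1 : k < r := by nlinarith
    have h2 : r < k + 2 := by nlinarith
    obtain rfl : r = k + 1 := by omega
    have : 2 * k = 3 := by nlinarith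
    omega
  have h := irrational_sqrt_natCast_iff.2 hns
  push_cast at h
  have h2 := (h.natCast_add k).div_natCast (two_ne_zero)
  simpa [tau] using h2

lemma sub_inv_eq_iff_eq_tau {x : ℝ} (hx : 0 < x) (k : ℕ) : x - x⁻¹ = k ↔ x = tau k := by
  have ht := tau_pos k
  have hsq := tau_sq k
  constructor
  · intro h
    field_simp at h
    exact pos_root_unique (a := k) (b := 1) (c := 1) (d := 0) one_pos one_pos hx ht
      (by linarith) (by linarith)
  · rintro rfl
    field_simp
    linarith

lemma intCast_add_mul_eq_zero {x : ℝ} (hx : Irrational x) {p q : ℤ} (h : (p : ℝ) * x + q = 0) :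
    p = 0 ∧ q = 0 := by
  have hp : p = 0 := by
    by_contra hp
    exact ((hx.intCast_mul hp).add_intCast q).ne_zero h
  subst hp
  exact ⟨rfl, by simpa using h⟩

/-- Substituting `τ² = k τ + 1` leaves an integer linear relation between `τ` and `1`, whose
coefficients must vanish. -/
lemma quadratic_tau_iff {k : ℕ} (hk : 1 ≤ k) (a b c d : ℕ) :
    (c : ℝ) * tau k ^ 2 + d * tau k = a * tau k + b ↔ a = k * c + d ∧ b = c := by
  rw [tau_sq]
  constructor
  · intro h
    have h2 : (((k * c + d - a : ℤ)) : ℝ) * tau k + ((c - b : ℤ) : ℝ) = 0 := by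
      push_cast
      linear_combination h
    obtain ⟨h3, h4⟩ := intCast_add_mul_eq_zero (irrational_tau hk) h2
    constructor
    · zify
      linarith
    · omega
  · rintro ⟨rfl, rfl⟩
    push_cast
    ring

end BinarySubst

open BinarySubst

/-! ### The three equivalences -/

theorem mainTheorem5
    (ρ : BinarySubst.Substitution) (hρ : ρ.IsPrimitive)
    (w : BinarySubst.InfWord) (hw : w ∈ BinarySubst.infBoth) (hfix : ρ.IsFixedPoint w)
    (k : ℕ) (hk : 1 ≤ k) :
    List.TFAE [
      Tendsto (fun n : ℕ => (BinarySubst.relPos w n : ℝ) / (n : ℝ)) atTop (𝓝 (k : ℝ)),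
      BinarySubst.IsRightPFEigenvector ρ.matrix ![BinarySubst.tau k, 1],
      ∃ m n : ℕ, 1 ≤ m ∧ ρ.matrix = !![k * m + n, m; m, n]] ∧
    List.TFAE [
      Tendsto (fun n : ℕ => (BinarySubst.relPos w n : ℝ) / (n : ℝ)) atTop (𝓝 (-(k : ℝ))),
      BinarySubst.IsRightPFEigenvector ρ.matrix ![1, BinarySubst.tau k],
      ∃ m n : ℕ, 1 ≤ m ∧ ρ.matrix = !![n, m; m, k * m + n]] ∧
    List.TFAE [
      Tendsto (fun n : ℕ => (BinarySubst.relPos w n : ℝ) / (n : ℝ)) atTop (𝓝 0),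
      BinarySubst.IsRightPFEigenvector ρ.matrix ![1, 1],
      ∃ a b c d : ℕ, a + b = c + d ∧ ρ.matrix = !![a, b; c, d]] := by

  have hb : 0 < ρ.matrix 0 1 := List.count_pos_iff.2 (hρ.mem_of_ne (by decide : ltrA ≠ ltrB))
  have hc : 0 < ρ.matrix 1 0 := List.count_pos_iff.2 (hρ.mem_of_ne (by decide : ltrB ≠ ltrA))
  have hbR : (0 : ℝ) < ρ.matrix 0 1 := by exact_mod_cast hb
  have hcR : (0 : ℝ) < ρ.matrix 1 0 := by exact_mod_cast hc
  obtain ⟨x, hx, hroot⟩ := exists_pos_root (a := ρ.matrix 0 0) (d := ρ.matrix 1 1) hbR hcR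
  have hr := tendsto_relPos_div hw hx (tendsto_discrepancy hρ hfix hx hroot)
  -- The limit exists unconditionally, so each condition (i) is an equation for `x`.
  have hlim : ∀ y : ℝ, Tendsto (fun n : ℕ => (relPos w n : ℝ) / (n : ℝ)) atTop (𝓝 y) ↔
      x - x⁻¹ = y := fun y => ⟨fun h => tendsto_nhds_unique hr h, fun h => h ▸ hr⟩
  have hpf : ∀ {s t : ℝ}, 0 < s → 0 < t →
      (IsRightPFEigenvector ρ.matrix ![s, t] ↔ x = s / t) := fun {s t} hs ht => by
    rw [isRightPFEigenvector_iff _ hs ht]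
    constructor
    · intro h
      refine pos_root_unique hbR hcR hx (div_pos hs ht) hroot ?_
      field_simp
      linear_combination h
    · intro h
      rw [h] at hroot
      field_simp at hroot
      linear_combination hroot
  have ht := tau_pos k
  have heta : ρ.matrix = !![ρ.matrix 0 0, ρ.matrix 0 1; ρ.matrix 1 0, ρ.matrix 1 1] :=
    Matrix.eta_fin_two _
  refine ⟨?_, ?_, ?_⟩
  · tfae_have 1 ↔ 2 := by
      rw [hlim, hpf ht one_pos, sub_inv_eq_iff_eq_tau hx, div_one]
    tfae_have 2 ↔ 3 := by
      rw [isRightPFEigenvector_iff _ ht one_pos]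
      simp only [mul_one, one_pow]
      rw [quadratic_tau_iff hk]
      constructor
      · rintro ⟨h1, h2⟩
        refine ⟨ρ.matrix 1 0, ρ.matrix 1 1, hc, ?_⟩
        rw [← h1]
        conv_lhs => rw [heta, h2]
      · rintro ⟨m, n, -, hM⟩
        simp [hM]
    tfae_finish
  · tfae_have 1 ↔ 2 := by
      -- `x - x⁻¹ = -k` is the equation of case (a) for `x⁻¹`.
      rw [hlim, hpf one_pos ht, one_div, ← inv_eq_iff_eq_inv,
        ← sub_inv_eq_iff_eq_tau (inv_pos.2 hx), inv_inv]
      constructor <;> intro h <;> linarith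
    tfae_have 2 ↔ 3 := by
      rw [isRightPFEigenvector_iff _ one_pos ht]
      simp only [one_mul, one_pow, mul_one]
      -- Exchanging the letters swaps `a` with `d` and `b` with `c`, reducing to the quadratic of
      -- case (a).
      rw [eq_comm, add_comm, add_comm (ρ.matrix 1 0 : ℝ), quadratic_tau_iff hk]
      constructor
      · rintro ⟨h1, h2⟩
        refine ⟨ρ.matrix 0 1, ρ.matrix 0 0, hb, ?_⟩
        rw [← h1]
        conv_lhs => rw [heta, h2]
      · rintro ⟨m, n, -, hM⟩
        simp [hM]
    tfae_finish
  · tfae_have 1 ↔ 2 := by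
      rw [hlim, hpf one_pos one_pos, div_one, sub_eq_zero]
      constructor
      · intro h
        field_simp at h
        nlinarith
      · rintro rfl
        simp
    tfae_have 2 ↔ 3 := by
      rw [isRightPFEigenvector_iff _ one_pos one_pos]
      simp only [one_pow, mul_one]
      constructor
      · intro h
        exact ⟨_, _, _, _, by exact_mod_cast h.symm, heta⟩
      · rintro ⟨a, b, c, d, h, hM⟩
        simp only [hM, Matrix.of_apply, Matrix.cons_val', Matrix.cons_val_zero,
          Matrix.cons_val_one, Matrix.cons_val_fin_one]
        exact_mod_cast h.symm
    tfae_finish
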